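/- In the problem PART, a sequence $X=w_1,\dots,w_n$ of non-negative integers has to be partitioned into $p$ contiguous (possibly empty) blocks by placing at most $p-1$ separators, so as to minimize the bottleneck value, i.e. the weight of a heaviest block; let $\mathrm{opt}_p(X)$ be the minimum. A deterministic preemptive online algorithm knows $p$, receives the integers one by one and maintains a set of at most $p-1$ separators, which is determined by the integers received so far: initially there is none, and upon receiving $w_i$ it may remove separators that are in place, and it may insert a separator only directly after $w_i$. There is an absolute constant $C>0$ such that for every $p\ge 2$ that is a power of two there is a deterministic preemptive online algorithm $\mathcal A_p$ for PART with the following property: for every finite sequence $X$ of non-negative integers, with total weight $S$ and largest element $\max$, the bottleneck value of the partitioning that $\mathcal A_p$ has in place after receiving $X$ is at most $$\Bigl(1.68+\frac{C}{p}+C\,\frac{p\cdot \max}{S}\Bigr)\cdot \mathrm{opt}_p(X)$$ (if $S=0$, both bottleneck values are $0$). In other words, the competitive ratio is $1.68+O(1/p)+O(\max/S)$, where the constant in $O(1/p)$ is absolute and the one in $O(\max/S)$ is linear in $p$. -/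

import Mathlib

namespace OnlinePart

/-- Weight of the `j`-th block (`j = 0, 1, …`) of the integer sequence `X` when the separators in
place are `T`. A separator `s ∈ T` sits directly after the first `s` integers of `X`, so the integer
with zero-based index `i` lies in block number `#{s ∈ T | s ≤ i}`. -/
def blockWeight (X : List ℕ) (T : Finset ℕ) (j : ℕ) : ℕ :=
  ∑ i ∈ Finset.range X.length with (T.filter (fun s => s ≤ i)).card = j, X.getD i 0

/-- Weight of a heaviest block of `X` when the separators in place are `T`. -/
def bottleneck (X : List ℕ) (T : Finset ℕ) : ℕ :=
  (Finset.range (T.card + 1)).sup (blockWeight X T)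

/-- `T` is a set of at most `p - 1` separator positions for a sequence of length `n`. Fewer than
`p - 1` distinct positions stand for a partitioning into `p` blocks some of which are empty. -/
def IsPartitioning (p n : ℕ) (T : Finset ℕ) : Prop :=
  T ⊆ Finset.range (n + 1) ∧ T.card < p

/-- The optimal (minimum) bottleneck value of a partitioning of `X` into `p` contiguous blocks. -/
noncomputable def optBottleneck (p : ℕ) (X : List ℕ) : ℕ :=
  sInf {b : ℕ | ∃ T : Finset ℕ, IsPartitioning p X.length T ∧ b = bottleneck X T}

/-- For `p ≥ 1` the minimum in the definition of `optBottleneck` is attained. -/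
theorem exists_bottleneck_eq_opt {p : ℕ} (hp : 0 < p) (X : List ℕ) :
    ∃ T : Finset ℕ, IsPartitioning p X.length T ∧ optBottleneck p X = bottleneck X T := by
  have hne : {b : ℕ | ∃ T : Finset ℕ,
      IsPartitioning p X.length T ∧ b = bottleneck X T}.Nonempty :=
    ⟨bottleneck X ∅, ∅, ⟨by simp, by simpa using hp⟩, rfl⟩
  exact Nat.sInf_mem hne

/-- A deterministic preemptive online algorithm that maintains at most `p - 1` separators.
`sep X` is the set of separators in place after the requests in the list `X` have been processed,
in order of arrival; it depends on these requests only. When a new request `w` is processed,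
separators in place may be removed, and the only separator that may be inserted is the one directly
after `w`. -/
structure PreemptiveAlgorithm (p : ℕ) where
  sep : List ℕ → Finset ℕ
  sep_nil : sep [] = ∅
  sep_append : ∀ (X : List ℕ) (w : ℕ), sep (X ++ [w]) ⊆ insert (X.length + 1) (sep X)
  card_sep_lt : ∀ X : List ℕ, (sep X).card < p

/-- The largest element of a sequence (`0` for the empty sequence). -/
def maxWeight (X : List ℕ) : ℕ := X.foldr max 0

end OnlinePart

namespace OnlinePart

/-! ### Block weights and prefix sums -/

/-! The optimum is at least `S / p`, so it suffices to keep every block below `1.68 * S / p` up to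
`O(max)`. Candidate separators sit where the prefix weight first reaches `q ^ m`, with `q ^ n = 2`;
seen back from the current total `S`, each octave of `n` levels halves the weight. Keeping every `2
^ o`-th level of octave `o` gives blocks of about `(S / 2 ^ o) * (q ^ 2 ^ o - 1) ≈ S * log 2 / n`,
uniformly in `o`, while the number of separators halves from octave to octave, about `2 * n` in all.
With `p = 64 * 2 ^ J` and `n = 28 * 2 ^ J` the ratio is near `64 / 28 * log 2 < 1.6`; the slack pays
for rounding and for the last few octaves, whose spacing stays `2 ^ J`. Everything older weighs
about `S / 2 ^ (J + 6) = S / p` and goes into the first block. The scheme is online because growth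
of `S` only moves a level to an older octave with a stronger divisibility condition
(`mem_keptLevels_of_le`). The count is `card_keptLevels_le`, the weight bound
`bottleneck_geometric_le`; small `p` are absorbed by the constant. -/

theorem sum_range_getD (X : List ℕ) (b : ℕ) :
    ∑ i ∈ Finset.range b, X.getD i 0 = (X.take b).sum := by
  induction b with
  | zero => simp
  | succ b ih =>
    rw [Finset.sum_range_succ, ih]
    by_cases h : b < X.length
    · rw [List.take_succ_eq_append_getElem h]
      simp [h]
    · rw [List.take_of_length_le (by omega), List.take_of_length_le (by omega)]
      simp [not_lt.mp h]

theorem sum_take_mono (X : List ℕ) : Monotone fun b => (X.take b).sum := by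
  intro a b h
  simp only [← sum_range_getD]
  exact Finset.sum_le_sum_of_subset (Finset.range_subset_range.mpr h)

theorem sum_take_le (X : List ℕ) (b : ℕ) : (X.take b).sum ≤ X.sum := by
  rw [← List.sum_take_add_sum_drop X b]
  exact Nat.le_add_right _ _

theorem le_maxWeight {X : List ℕ} {w : ℕ} (h : w ∈ X) : w ≤ maxWeight X := by
  induction X with
  | nil => simp at h
  | cons a X ih =>
    simp only [maxWeight, List.foldr_cons] at ih ⊢
    rcases List.mem_cons.mp h with rfl | h
    · exact le_max_left _ _
    · exact (ih h).trans (le_max_right _ _)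

theorem sum_take_succ_le (X : List ℕ) (b : ℕ) :
    (X.take (b + 1)).sum ≤ (X.take b).sum + maxWeight X := by
  rw [← sum_range_getD, ← sum_range_getD, Finset.sum_range_succ]
  by_cases h : b < X.length
  · have : X.getD b 0 = X[b] := by simp [h]
    rw [this]
    exact Nat.add_le_add_left (le_maxWeight (List.getElem_mem h)) _
  · simp [not_lt.mp h]

theorem one_le_maxWeight {X : List ℕ} (h : 0 < X.sum) : 1 ≤ maxWeight X := by
  by_contra hc
  have : X.sum = 0 := List.sum_eq_zero fun w hw => by
    have := le_maxWeight hw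
    omega
  omega

/-- A bound on the weight of every segment without interior separators bounds the bottleneck. -/
theorem bottleneck_le_of_gap {X : List ℕ} {T : Finset ℕ} {B : ℝ} (hB : 0 ≤ B)
    (H : ∀ a b, a < b → b ≤ X.length → (∀ s ∈ T, a < s → b ≤ s) →
      ((X.take b).sum : ℝ) ≤ (X.take a).sum + B) :
    (bottleneck X T : ℝ) ≤ B := by
  rw [← Nat.le_floor_iff hB]
  refine Finset.sup_le fun j _ => ?_
  rw [Nat.le_floor_iff hB, blockWeight]
  set F := {i ∈ Finset.range X.length | (T.filter (fun s => s ≤ i)).card = j} with hF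
  rcases F.eq_empty_or_nonempty with h0 | hne
  · simpa [h0] using hB
  have hmin := Finset.min'_mem F hne
  have hmax := Finset.max'_mem F hne
  have hle : F.min' hne ≤ F.max' hne := Finset.min'_le _ _ hmax
  generalize hx : F.min' hne = x at hmin hle
  generalize hy : F.max' hne = y at hmax hle
  have hx2 := (Finset.mem_filter.mp hmin).2
  have hy1 := Finset.mem_range.mp (Finset.mem_filter.mp hmax).1
  have hy2 := (Finset.mem_filter.mp hmax).2
  have hsub : T.filter (fun s => s ≤ x) = T.filter (fun s => s ≤ y) := by
    refine Finset.eq_of_subset_of_card_le (fun s hs => ?_) (by rw [hx2, hy2])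
    simp only [Finset.mem_filter] at hs ⊢
    exact ⟨hs.1, hs.2.trans hle⟩
  have key := H x (y + 1) (by omega) (by omega) fun s hs hxs => by
    by_contra hc
    have : s ∈ T.filter (fun s => s ≤ x) := by
      rw [hsub]
      exact Finset.mem_filter.mpr ⟨hs, by omega⟩
    have := (Finset.mem_filter.mp this).2
    omega
  have hFs : F ⊆ Finset.Ico x (y + 1) := fun i hi => by
    have h1 := Finset.min'_le F i hi
    have h2 := Finset.le_max' F i hi
    rw [Finset.mem_Ico]
    omega
  have h1 : ∑ i ∈ F, X.getD i 0 ≤ ∑ i ∈ Finset.Ico x (y + 1), X.getD i 0 :=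
    Finset.sum_le_sum_of_subset hFs
  have h2 := Finset.sum_range_add_sum_Ico (fun i => X.getD i 0) (show x ≤ y + 1 by omega)
  rw [sum_range_getD, sum_range_getD] at h2
  have h3 : (X.take x).sum + ∑ i ∈ F, X.getD i 0 ≤ (X.take (y + 1)).sum := by omega
  have h4 : ((X.take x).sum : ℝ) + ((∑ i ∈ F, X.getD i 0 : ℕ) : ℝ) ≤ (X.take (y + 1)).sum := by
    exact_mod_cast h3
  linarith

theorem bottleneck_le_sum (X : List ℕ) (T : Finset ℕ) : bottleneck X T ≤ X.sum := by
  have h : (bottleneck X T : ℝ) ≤ (X.sum : ℝ) :=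
    bottleneck_le_of_gap (Nat.cast_nonneg _) fun a b _ _ _ => by
      have := sum_take_le X b
      exact_mod_cast this.trans (Nat.le_add_left _ _)
  exact_mod_cast h

theorem sum_le_card_mul_bottleneck (X : List ℕ) (T : Finset ℕ) :
    X.sum ≤ (T.card + 1) * bottleneck X T := by
  have h1 : X.sum = ∑ j ∈ Finset.range (T.card + 1), blockWeight X T j := by
    have h := sum_range_getD X X.length
    rw [List.take_length] at h
    rw [← h]
    refine (Finset.sum_fiberwise_of_maps_to (fun i _ => ?_) _).symm
    exact Finset.mem_range.mpr (Nat.lt_succ_of_le (Finset.card_filter_le _ _))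
  rw [h1]
  have := Finset.sum_le_card_nsmul (Finset.range (T.card + 1)) (blockWeight X T) (bottleneck X T)
    fun j hj => Finset.le_sup (f := blockWeight X T) hj
  simpa using this

/-- Averaging over the blocks; this is the only lower bound on the optimum that is needed. -/
theorem sum_le_mul_optBottleneck {p : ℕ} (hp : 0 < p) (X : List ℕ) :
    X.sum ≤ p * optBottleneck p X := by
  obtain ⟨T, hT, h⟩ := exists_bottleneck_eq_opt hp X
  rw [h]
  exact (sum_le_card_mul_bottleneck X T).trans (Nat.mul_le_mul_right _ hT.2)

/-! ### The levels that keep a separator -/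

/-- Of the levels `0, …, L - 1`, the ones that keep their separator: going back from level `L - 1`,
the levels are cut into octaves of `n` levels each; octave `o` keeps the multiples of
`2 ^ min o J`, and only the last `A` octaves keep anything. -/
def keptLevels (n J A L : ℕ) : Finset ℕ :=
  (Finset.range L).filter fun m => (L - 1 - m) / n < A ∧ 2 ^ min ((L - 1 - m) / n) J ∣ m

theorem mem_keptLevels {n J A L m : ℕ} : m ∈ keptLevels n J A L ↔
    m < L ∧ (L - 1 - m) / n < A ∧ 2 ^ min ((L - 1 - m) / n) J ∣ m := by
  simp [keptLevels]

/-- Octave numbers grow with the number of levels and the spacings form a divisibility chain, so a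
dropped level never has to return. -/
theorem mem_keptLevels_of_le {n J A L L' m : ℕ} (hL : L ≤ L') (hm : m < L)
    (h : m ∈ keptLevels n J A L') : m ∈ keptLevels n J A L := by
  rw [mem_keptLevels] at h ⊢
  have hdiv : (L - 1 - m) / n ≤ (L' - 1 - m) / n := Nat.div_le_div_right (by omega)
  exact ⟨hm, hdiv.trans_lt h.2.1, (pow_dvd_pow 2 (min_le_min_right J hdiv)).trans h.2.2⟩

/-- The next level at the local spacing lies in the same or a newer octave, whose spacing divides
the local one. -/
theorem add_mem_keptLevels {n J A L m : ℕ} (h : m ∈ keptLevels n J A L)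
    (hL : m + 2 ^ min ((L - 1 - m) / n) J < L) :
    m + 2 ^ min ((L - 1 - m) / n) J ∈ keptLevels n J A L := by
  rw [mem_keptLevels] at h ⊢
  generalize he : 2 ^ min ((L - 1 - m) / n) J = e at *
  have hdiv : (L - 1 - (m + e)) / n ≤ (L - 1 - m) / n := Nat.div_le_div_right (by omega)
  refine ⟨hL, hdiv.trans_lt h.2.1, ?_⟩
  have : 2 ^ min ((L - 1 - (m + e)) / n) J ∣ e := by
    rw [← he]
    exact pow_dvd_pow 2 (min_le_min_right J (by rw [he]; exact hdiv))
  exact (this.trans h.2.2).add this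

theorem card_keptLevels_le {n J A L : ℕ} (hn : 0 < n) (hJ : 2 ^ J ∣ n) :
    (keptLevels n J A L).card ≤ ∑ o ∈ Finset.range A, n / 2 ^ min o J := by
  rw [Finset.card_eq_sum_card_fiberwise (f := fun m => (L - 1 - m) / n) (t := Finset.range A)
    fun m hm => Finset.mem_coe.mpr (Finset.mem_range.mpr (mem_keptLevels.mp hm).2.1)]
  refine Finset.sum_le_sum fun o ho => ?_
  have hoA := Finset.mem_range.mp ho
  set d := 2 ^ min o J with hd
  have hd0 : 0 < d := by positivity
  have hdn : d ∣ n := (pow_dvd_pow 2 (min_le_right o J)).trans hJ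
  obtain ⟨c, hc⟩ : ∃ c, A = o + 1 + c := ⟨A - (o + 1), by omega⟩
  have hdA : d ∣ A * n := hdn.mul_left A
  have hcard : (Finset.Ioc ((L - 1 + c * n) / d) ((L - 1 + c * n + n) / d)).card = n / d := by
    rw [Nat.card_Ioc, Nat.add_div_of_dvd_left hdn, Nat.add_sub_cancel_left]
  rw [← hcard]
  -- An octave is a window of `n` consecutive levels, with `n / d` multiples of `d`. Shifting by `A
  -- * n`, itself a multiple of `d`, avoids truncated subtraction.
  refine Finset.card_le_card_of_injOn (fun m => (m + A * n) / d) (fun m hm => ?_)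
    fun m hm m' hm' h => ?_
  · obtain ⟨hm, ho'⟩ := Finset.mem_filter.mp hm
    obtain ⟨hmL, -, hdm⟩ := mem_keptLevels.mp hm
    rw [ho'] at hdm
    have h1 : o * n ≤ L - 1 - m := by
      rw [← ho']
      exact Nat.div_mul_le_self _ _
    have h2 : L - 1 - m < (o + 1) * n := by
      rw [← ho']
      exact Nat.lt_mul_of_div_lt (Nat.lt_succ_self _) hn
    have hAn : A * n = o * n + n + c * n := by rw [hc]; ring
    have h3 : (o + 1) * n = o * n + n := by ring
    rw [Finset.mem_coe, Finset.mem_Ioc]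
    constructor
    · rw [Nat.div_lt_iff_lt_mul hd0, Nat.div_mul_cancel (hdm.add hdA)]
      omega
    · exact Nat.div_le_div_right (by omega)
  · obtain ⟨hm, ho'⟩ := Finset.mem_filter.mp hm
    obtain ⟨hm', ho''⟩ := Finset.mem_filter.mp hm'
    have hdm := (mem_keptLevels.mp hm).2.2
    have hdm' := (mem_keptLevels.mp hm').2.2
    rw [ho'] at hdm
    rw [ho''] at hdm'
    have := (Nat.div_left_inj (hdm.add hdA) (hdm'.add hdA)).mp h
    omega

/-- The first `J` octaves form a geometric sum `56 * 2 ^ J - 56`; the other six contribute `28`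
each. -/
theorem sum_octaves (J : ℕ) :
    ∑ o ∈ Finset.range (J + 6), 28 * 2 ^ J / 2 ^ min o J = 56 * 2 ^ J + 112 := by
  have h1 : ∀ J : ℕ, ∑ o ∈ Finset.range J, 28 * 2 ^ (J - o) + 56 = 56 * 2 ^ J := by
    intro J
    induction J with
    | zero => simp
    | succ J ih =>
      rw [Finset.sum_range_succ']
      simp only [Nat.add_sub_add_right, Nat.sub_zero]
      rw [pow_succ]
      omega
  have h2 : ∀ o ∈ Finset.range J, 28 * 2 ^ J / 2 ^ min o J = 28 * 2 ^ (J - o) := fun o ho => by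
    have ho := Finset.mem_range.mp ho
    rw [min_eq_left ho.le, Nat.mul_div_assoc _ (pow_dvd_pow 2 ho.le),
      Nat.pow_div ho.le two_pos]
  have h3 : ∀ i ∈ Finset.range 6, 28 * 2 ^ J / 2 ^ min (J + i) J = 28 := fun i _ => by
    rw [min_eq_right (by omega), Nat.mul_div_cancel _ (by positivity)]
  rw [Finset.sum_range_add, Finset.sum_congr rfl h2, Finset.sum_congr rfl h3]
  have := h1 J
  simp only [Finset.sum_const, Finset.card_range, smul_eq_mul]
  omega

/-! ### The algorithm -/

/-- The number of levels `1, q, q ^ 2, …` that are at most `S`. -/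
noncomputable def levelCount (q : ℝ) (S : ℕ) : ℕ := sInf {m : ℕ | (S : ℝ) < q ^ m}

/-- The length of the shortest prefix of `X` whose weight reaches the level `q ^ m`. -/
noncomputable def firstReach (q : ℝ) (X : List ℕ) (m : ℕ) : ℕ :=
  sInf {i : ℕ | q ^ m ≤ ((X.take i).sum : ℝ)}

section Levels

variable {q : ℝ}

theorem lt_pow_levelCount (hq : 1 < q) (S : ℕ) : (S : ℝ) < q ^ levelCount q S :=
  Nat.sInf_mem (s := {m : ℕ | (S : ℝ) < q ^ m}) (pow_unbounded_of_one_lt _ hq)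

theorem lt_levelCount_iff (hq : 1 < q) {S m : ℕ} : m < levelCount q S ↔ q ^ m ≤ (S : ℝ) := by
  constructor
  · intro h
    exact not_lt.mp (Nat.notMem_of_lt_sInf h)
  · intro h
    exact (pow_lt_pow_iff_right₀ hq).mp (h.trans_lt (lt_pow_levelCount hq S))

theorem levelCount_mono (hq : 1 < q) : Monotone (levelCount q) := by
  intro S S' h
  refine Nat.sInf_le ?_
  have : (S : ℝ) ≤ S' := by exact_mod_cast h
  exact this.trans_lt (lt_pow_levelCount hq S')

theorem pow_le_sum_take_firstReach {X : List ℕ} {m : ℕ} (h : q ^ m ≤ (X.sum : ℝ)) :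
    q ^ m ≤ ((X.take (firstReach q X m)).sum : ℝ) :=
  Nat.sInf_mem (s := {i : ℕ | q ^ m ≤ ((X.take i).sum : ℝ)}) 
    ⟨X.length, by rwa [Set.mem_ofPred_eq, List.take_length]⟩

theorem firstReach_le_length {X : List ℕ} {m : ℕ} (h : q ^ m ≤ (X.sum : ℝ)) :
    firstReach q X m ≤ X.length :=
  Nat.sInf_le (by rwa [Set.mem_ofPred_eq, List.take_length])

theorem sum_take_lt_of_lt_firstReach {X : List ℕ} {m i : ℕ} (h : i < firstReach q X m) :
    ((X.take i).sum : ℝ) < q ^ m :=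
  not_le.mp (Nat.notMem_of_lt_sInf h)

/-- The prefix one element shorter is still below the level, so the overshoot is a single element.
-/
theorem sum_take_le_of_le_firstReach (hq : 1 < q) {X : List ℕ} {m i : ℕ}
    (h : i ≤ firstReach q X m) : ((X.take i).sum : ℝ) ≤ q ^ m + maxWeight X := by
  rcases i with _ | i
  · simp only [List.take_zero, List.sum_nil, Nat.cast_zero]
    positivity
  · have h1 := sum_take_lt_of_lt_firstReach (Nat.lt_of_succ_le h)
    have h2 : ((X.take (i + 1)).sum : ℝ) ≤ (X.take i).sum + maxWeight X := by
      exact_mod_cast sum_take_succ_le X i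
    linarith

theorem firstReach_append {X : List ℕ} {m : ℕ} (w : ℕ) (h : q ^ m ≤ (X.sum : ℝ)) :
    firstReach q (X ++ [w]) m = firstReach q X m := by
  have hl := firstReach_le_length h
  have hle : firstReach q (X ++ [w]) m ≤ firstReach q X m := by
    refine Nat.sInf_le ?_
    rw [Set.mem_ofPred_eq, List.take_append_of_le_length hl]
    exact pow_le_sum_take_firstReach h
  refine le_antisymm hle (Nat.sInf_le ?_)
  have h1 : q ^ m ≤ ((X ++ [w]).sum : ℝ) := by
    rw [List.sum_append]
    push_cast
    exact h.trans (by simp)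
  have h2 := pow_le_sum_take_firstReach h1
  rwa [List.take_append_of_le_length (hle.trans hl)] at h2

theorem firstReach_append_of_lt {X : List ℕ} {m w : ℕ} (h : (X.sum : ℝ) < q ^ m)
    (h' : q ^ m ≤ ((X ++ [w]).sum : ℝ)) : firstReach q (X ++ [w]) m = X.length + 1 := by
  refine le_antisymm (by simpa using firstReach_le_length h') ?_
  by_contra hc
  have h2 := pow_le_sum_take_firstReach h'
  rw [List.take_append_of_le_length (by omega)] at h2
  have h3 : ((X.take (firstReach q (X ++ [w]) m)).sum : ℝ) ≤ X.sum := by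
    exact_mod_cast sum_take_le _ _
  linarith

/-- The algorithm that separates at the geometric levels `q ^ m` and keeps those selected by
`keptLevels`. -/
noncomputable def geometricAlgorithm (hq : 1 < q) (n J A p : ℕ)
    (hp : ∀ L, (keptLevels n J A L).card < p) : PreemptiveAlgorithm p where
  sep X := (keptLevels n J A (levelCount q X.sum)).image (firstReach q X)
  sep_nil := by
    have : levelCount q ([] : List ℕ).sum = 0 := Nat.le_zero.mp (Nat.sInf_le (by simp))
    rw [this]
    simp [keptLevels]
  sep_append X w := by
    intro s hs
    obtain ⟨m, hm, rfl⟩ := Finset.mem_image.mp hs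
    have hm1 := (lt_levelCount_iff hq).mp (mem_keptLevels.mp hm).1
    rw [Finset.mem_insert]
    rcases lt_or_ge (X.sum : ℝ) (q ^ m) with h | h
    · exact Or.inl (firstReach_append_of_lt h hm1)
    · rw [firstReach_append w h]
      refine Or.inr (Finset.mem_image_of_mem _ (mem_keptLevels_of_le (levelCount_mono hq ?_)
        ((lt_levelCount_iff hq).mpr h) hm))
      simp
  card_sep_lt X := Finset.card_image_le.trans_lt (hp _)

/-- If `q ^ n = 2`, then the separators of `geometricAlgorithm` leave blocks of weight at most
`B * X.sum` up to twice the largest element. -/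
theorem bottleneck_geometric_le (hq : 1 < q) {n J A : ℕ} (hn : 0 < n) (hA : 0 < A)
    (hqn : q ^ n = 2) (hJn : 2 ^ J ≤ n) {B : ℝ}
    (hB : ∀ j ≤ J, q ^ 2 ^ j - 1 ≤ 2 ^ j * B) (hBA : q ^ 2 ^ J ≤ 2 ^ A * B) (X : List ℕ) :
    (bottleneck X ((keptLevels n J A (levelCount q X.sum)).image (firstReach q X)) : ℝ) ≤
      B * X.sum + 2 * maxWeight X := by
  have hq0 : 0 < q := by linarith
  have hB0 : 0 < B := by
    by_contra hc
    have : (2 : ℝ) ^ A * B ≤ 0 := mul_nonpos_of_nonneg_of_nonpos (by positivity) (not_lt.mp hc)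
    have : 0 < q ^ 2 ^ J := by positivity
    linarith
  set L := levelCount q X.sum with hL
  have hS := lt_pow_levelCount hq X.sum
  rw [← hL] at hS
  have hlev : ∀ {m}, m < L ↔ q ^ m ≤ (X.sum : ℝ) := lt_levelCount_iff hq
  refine bottleneck_le_of_gap (by positivity) fun a b hab hb hT => ?_
  have hPb : ((X.take b).sum : ℝ) ≤ X.sum := by exact_mod_cast sum_take_le X b
  have hmax0 : (0 : ℝ) ≤ maxWeight X := Nat.cast_nonneg _
  have hPa0 : (0 : ℝ) ≤ (X.take a).sum := Nat.cast_nonneg _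
  have hBS : 0 ≤ B * X.sum := by positivity
  rcases Nat.eq_zero_or_pos L with hL0 | hLpos
  · rw [hL0, pow_zero] at hS
    have h1 : X.sum = 0 := by
      have : X.sum < 1 := by exact_mod_cast hS
      omega
    rw [h1] at hPb hBS
    rw [h1]
    push_cast at *
    linarith
  -- a level in octave `o` is at most `X.sum / 2 ^ o`
  have hoct : ∀ o m, m + o * n < L → 2 ^ o * q ^ m ≤ (X.sum : ℝ) := fun o m h => by
    refine le_trans (le_of_eq ?_) (hlev.mp h)
    rw [pow_add, mul_comm o n, pow_mul, hqn, mul_comm]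
  -- a kept level above `a`, or a level above the total weight, bounds the segment
  have hnext : ∀ m, (m < L → m ∈ keptLevels n J A L ∧ a < firstReach q X m) →
      ((X.take b).sum : ℝ) ≤ q ^ m + maxWeight X := fun m hm => by
    by_cases hmL : m < L
    · obtain ⟨hk, ha⟩ := hm hmL
      exact sum_take_le_of_le_firstReach hq (hT _ (Finset.mem_image_of_mem _ hk) ha)
    · have := pow_le_pow_right₀ hq.le (not_lt.mp hmL)
      linarith
  by_cases hex : ∃ m ∈ keptLevels n J A L, firstReach q X m ≤ a
  -- For the highest kept level reached by `a`, the next kept level is not yet reached there, so the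
  -- segment lies between two neighbouring kept levels.
  · obtain ⟨m, hm, hmmax⟩ := Finset.exists_max_image
      ((keptLevels n J A L).filter fun m => firstReach q X m ≤ a) id
      (by obtain ⟨m, hm, h⟩ := hex; exact ⟨m, Finset.mem_filter.mpr ⟨hm, h⟩⟩)
    obtain ⟨hmk, hma⟩ := Finset.mem_filter.mp hm
    obtain ⟨hmL, -, -⟩ := mem_keptLevels.mp hmk
    set j := min ((L - 1 - m) / n) J with hj
    have hPb' := hnext (m + 2 ^ j) fun h => by
      have hk := add_mem_keptLevels hmk h
      refine ⟨hk, ?_⟩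
      by_contra hc
      have h1 := hmmax _ (Finset.mem_filter.mpr ⟨hk, not_lt.mp hc⟩)
      have h2 : 0 < 2 ^ j := by positivity
      change m + 2 ^ j ≤ m at h1
      omega
    have hPa : q ^ m ≤ ((X.take a).sum : ℝ) := by
      refine (pow_le_sum_take_firstReach (hlev.mp hmL)).trans ?_
      exact_mod_cast sum_take_mono X hma
    have hjn : m + j * n < L := by
      have h1 : j * n ≤ L - 1 - m :=
        (Nat.mul_le_mul_right n (min_le_left _ _)).trans (Nat.div_mul_le_self _ _)
      omega
    have h1 := hoct j m hjn
    have h2 : q ^ m * (q ^ 2 ^ j - 1) ≤ q ^ m * (2 ^ j * B) :=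
      mul_le_mul_of_nonneg_left (hB j (min_le_right _ _)) (by positivity)
    have h3 : B * (2 ^ j * q ^ m) ≤ B * X.sum := mul_le_mul_of_nonneg_left h1 hB0.le
    rw [pow_add] at hPb'
    linarith
  · push Not at hex
    rcases Nat.lt_or_ge (L - 1) (A * n) with hlt | hge
    · have h0 : (0 : ℕ) ∈ keptLevels n J A L :=
        mem_keptLevels.mpr ⟨hLpos, by simpa using (Nat.div_lt_iff_lt_mul hn).mpr hlt, dvd_zero _⟩
      -- No octave has expired, so level `q ^ 0 = 1` is kept. This `1` is bounded by the largest
      -- element, whence the second `maxWeight X`.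
      have h1 := hnext 0 fun _ => ⟨h0, hex 0 h0⟩
      rw [pow_zero] at h1
      have h2 : (1 : ℝ) ≤ X.sum := by simpa using hlev.mp hLpos
      have h3 : (1 : ℝ) ≤ maxWeight X := by
        have : 0 < X.sum := by exact_mod_cast (by linarith : (0 : ℝ) < X.sum)
        exact_mod_cast one_le_maxWeight this
      linarith
    · set l := L - 1 - A * n with hl
      have hJ0 : 0 < 2 ^ J := by positivity
      -- Level `l` is the newest expired one; the next multiple of `2 ^ J` is kept whatever its
      -- octave, and it ends the first block.
      set m := 2 ^ J * (l / 2 ^ J + 1) with hm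
      have hlm : l < m := Nat.lt_mul_div_succ l hJ0
      have hml : m ≤ l + 2 ^ J := by
        rw [hm, mul_add, mul_one]
        exact Nat.add_le_add_right (Nat.mul_div_le _ _) _
      have hnA : n ≤ A * n := Nat.le_mul_of_pos_left n hA
      have hk : m ∈ keptLevels n J A L := by
        refine mem_keptLevels.mpr ⟨by omega, (Nat.div_lt_iff_lt_mul hn).mpr (by omega), ?_⟩
        exact (pow_dvd_pow 2 (min_le_right _ _)).trans (Dvd.intro _ rfl)
      have h1 := hnext m fun _ => ⟨hk, hex m hk⟩
      have h2 : q ^ m ≤ q ^ l * q ^ 2 ^ J := by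
        rw [← pow_add]
        exact pow_le_pow_right₀ hq.le hml
      have h3 := hoct A l (by omega)
      have h4 : q ^ l * q ^ 2 ^ J ≤ q ^ l * (2 ^ A * B) := mul_le_mul_of_nonneg_left hBA (by positivity)
      have h5 : B * (2 ^ A * q ^ l) ≤ B * X.sum := mul_le_mul_of_nonneg_left h3 hB0.le
      linarith

end Levels

/-! ### Numerical estimates and choice of parameters -/

theorem two_rpow_inv_sub_one_le {M : ℝ} (hM : 28 ≤ M) : (2 : ℝ) ^ (1 / M) - 1 ≤ 0.72 / M := by
  have hM0 : 0 < M := by linarith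
  have hl := Real.log_two_lt_d9
  have hl0 := Real.log_pos one_lt_two
  have hz : Real.log 2 * (1 / M) ≤ 0.025 := by
    rw [mul_one_div, div_le_iff₀ hM0]
    linarith
  have hz0 : 0 < Real.log 2 * (1 / M) := by positivity
  rw [Real.rpow_def_of_pos two_pos]
  have h := Real.abs_exp_sub_one_sub_id_le (x := Real.log 2 * (1 / M))
    (by rw [abs_of_pos hz0]; linarith)
  have h1 := (abs_le.mp h).2
  have h2 : (Real.log 2 * (1 / M)) ^ 2 ≤ 0.025 * (Real.log 2 * (1 / M)) := by
    rw [sq]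
    exact mul_le_mul_of_nonneg_right hz hz0.le
  have h3 : 1.025 * (Real.log 2 * (1 / M)) ≤ 0.72 / M := by
    rw [mul_one_div, ← mul_div_assoc]
    exact div_le_div_of_nonneg_right (by linarith) hM0.le
  linarith

/-- With `64 * 2 ^ J` blocks, `J ≥ 4`, there is an algorithm whose heaviest block exceeds
`1.68` times the average block weight by at most twice the largest element. -/
theorem exists_algorithm_of_large {J : ℕ} (hJ : 4 ≤ J) :
    ∃ A : PreemptiveAlgorithm (64 * 2 ^ J), ∀ X : List ℕ,
      (bottleneck X (A.sep X) : ℝ) ≤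
        1.68 / ((64 * 2 ^ J : ℕ) : ℝ) * X.sum + 2 * maxWeight X := by
  have hn : 0 < 28 * 2 ^ J := by positivity
  set q : ℝ := 2 ^ (1 / ((28 * 2 ^ J : ℕ) : ℝ)) with hqdef
  have hq : 1 < q := Real.one_lt_rpow one_lt_two (by positivity)
  have hqn : q ^ (28 * 2 ^ J) = 2 := by
    rw [hqdef, one_div]
    exact Real.rpow_inv_natCast_pow two_pos.le hn.ne'
  have h16 : 16 ≤ 2 ^ J := Nat.pow_le_pow_right two_pos hJ
  have hcard : ∀ L, (keptLevels (28 * 2 ^ J) J (J + 6) L).card < 64 * 2 ^ J := fun L => by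
    refine (card_keptLevels_le hn (Dvd.intro_left _ rfl)).trans_lt ?_
    rw [sum_octaves]
    -- `56 * 2 ^ J + 112 < 64 * 2 ^ J` amounts to `14 < 2 ^ J`, hence `J ≥ 4`.
    omega
  have hB : ∀ j ≤ J, q ^ 2 ^ j - 1 ≤ 2 ^ j * (1.68 / ((64 * 2 ^ J : ℕ) : ℝ)) := fun j hj => by
    obtain ⟨i, rfl⟩ := Nat.exists_eq_add_of_le hj
    have hi : (1 : ℝ) ≤ 2 ^ i := one_le_pow₀ one_le_two
    have hpow : q ^ 2 ^ j = 2 ^ (1 / (28 * 2 ^ i : ℝ)) := by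
      rw [hqdef, ← Real.rpow_mul_natCast two_pos.le]
      congr 1
      push_cast
      rw [pow_add]
      field_simp
    rw [hpow]
    refine (two_rpow_inv_sub_one_le (by linarith)).trans ?_
    -- `0.735 = 1.68 * 28 / 64`, just above the `0.72` of the exponential estimate.
    have : (2 : ℝ) ^ j * (1.68 / ((64 * 2 ^ (j + i) : ℕ) : ℝ)) = 0.735 / (28 * 2 ^ i) := by
      push_cast
      rw [pow_add]
      field_simp
      norm_num
    rw [this]
    exact div_le_div_of_nonneg_right (by norm_num) (by positivity)
  refine ⟨geometricAlgorithm hq _ J (J + 6) _ hcard, fun X =>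
    bottleneck_geometric_le hq hn (by omega) hqn (by omega) hB ?_ X⟩
  have h := hB J le_rfl
  have h1 : (2 : ℝ) ^ J * (1.68 / ((64 * 2 ^ J : ℕ) : ℝ)) = 1.68 / 64 := by
    push_cast
    field_simp
  have h2 : (2 : ℝ) ^ (J + 6) * (1.68 / ((64 * 2 ^ J : ℕ) : ℝ)) = 1.68 := by
    push_cast
    rw [pow_add]
    field_simp
    norm_num
  rw [h1] at h
  rw [h2]
  linarith

/-- The algorithm that never inserts a separator. -/
def trivialAlgorithm {p : ℕ} (hp : 0 < p) : PreemptiveAlgorithm p where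
  sep _ := ∅
  sep_nil := rfl
  sep_append _ _ := Finset.empty_subset _
  card_sep_lt _ := by simpa using hp

/-! ### Comparison with the optimum -/

/-- Any partitioning, even a single block, costs at most `S ≤ p * opt`, and `p ≤ 1000000 / p` in
this range. -/
theorem bottleneck_bound_of_small {p : ℕ} (hp : 0 < p) (hp' : p ≤ 1000) {c : ℝ} (hc : 0 ≤ c)
    (X : List ℕ) (T : Finset ℕ) :
    (bottleneck X T : ℝ) ≤ (1.68 + 1000000 * (1 / (p : ℝ)) + c) * optBottleneck p X := by
  have h1 : (bottleneck X T : ℝ) ≤ X.sum := by exact_mod_cast bottleneck_le_sum X T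
  have h2 : (X.sum : ℝ) ≤ p * optBottleneck p X := by exact_mod_cast sum_le_mul_optBottleneck hp X
  have hp0 : (0 : ℝ) < p := by exact_mod_cast hp
  have hp1 : (p : ℝ) ≤ 1000 := by exact_mod_cast hp'
  have h3 : (p : ℝ) ≤ 1000000 * (1 / (p : ℝ)) := by
    rw [mul_one_div, le_div_iff₀ hp0]
    nlinarith
  refine (h1.trans h2).trans (mul_le_mul_of_nonneg_right ?_ (Nat.cast_nonneg _))
  linarith

theorem bottleneck_bound_of_average {p : ℕ} (hp : 0 < p) {X : List ℕ} {T : Finset ℕ}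
    (h : (bottleneck X T : ℝ) ≤ 1.68 / (p : ℝ) * X.sum + 2 * maxWeight X) {c C : ℝ} (hc : 0 ≤ c)
    (hC : 2 ≤ C) :
    (bottleneck X T : ℝ) ≤
      (1.68 + c + C * ((p : ℝ) * maxWeight X / X.sum)) * optBottleneck p X := by
  have h1 : (X.sum : ℝ) ≤ p * optBottleneck p X := by exact_mod_cast sum_le_mul_optBottleneck hp X
  have hp0 : (0 : ℝ) < p := by exact_mod_cast hp
  have hopt : (0 : ℝ) ≤ optBottleneck p X := Nat.cast_nonneg _
  rcases Nat.eq_zero_or_pos X.sum with h0 | hpos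
  · have : bottleneck X T = 0 := Nat.le_zero.mp (h0 ▸ bottleneck_le_sum X T)
    rw [this, Nat.cast_zero]
    have : 0 ≤ C := by linarith
    positivity
  have hS : (0 : ℝ) < X.sum := by exact_mod_cast hpos
  have hM : (0 : ℝ) ≤ maxWeight X := Nat.cast_nonneg _
  have h2 : 1.68 / (p : ℝ) * X.sum ≤ 1.68 * optBottleneck p X := by
    rw [div_mul_eq_mul_div, div_le_iff₀ hp0]
    linarith
  have h3 : (maxWeight X : ℝ) ≤ (p : ℝ) * maxWeight X / X.sum * optBottleneck p X := by
    rw [div_mul_eq_mul_div, le_div_iff₀ hS]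
    have := mul_le_mul_of_nonneg_left h1 hM
    linarith
  have h4 : C * maxWeight X ≤ C * ((p : ℝ) * maxWeight X / X.sum * optBottleneck p X) :=
    mul_le_mul_of_nonneg_left h3 (by linarith)
  have h5 : 2 * (maxWeight X : ℝ) ≤ C * maxWeight X := mul_le_mul_of_nonneg_right hC hM
  have h6 : 0 ≤ c * optBottleneck p X := mul_nonneg hc hopt
  linarith

end OnlinePart

theorem mainTheorem2 :
    ∃ C : ℝ, 0 < C ∧ ∀ p : ℕ, 2 ≤ p → (∃ k : ℕ, p = 2 ^ k) →
      ∃ A : OnlinePart.PreemptiveAlgorithm p, ∀ X : List ℕ,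
        (OnlinePart.bottleneck X (A.sep X) : ℝ) ≤
          (1.68 + C * (1 / (p : ℝ)) + C * ((p : ℝ) * (OnlinePart.maxWeight X : ℝ) / (X.sum : ℝ))) *
            (OnlinePart.optBottleneck p X : ℝ) := by
  refine ⟨1000000, by norm_num, ?_⟩
  rintro p hp ⟨k, rfl⟩
  have hp0 : 0 < 2 ^ k := by omega
  -- With `k = J + 6`, the requirement `J ≥ 4` becomes `k ≥ 10`.
  rcases Nat.lt_or_ge k 10 with hk | hk
  · have hle : 2 ^ k ≤ 2 ^ 9 := Nat.pow_le_pow_right two_pos (by omega)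
    exact ⟨OnlinePart.trivialAlgorithm hp0, fun X =>
      OnlinePart.bottleneck_bound_of_small hp0 (by omega) (by positivity) X _⟩
  · obtain ⟨J, rfl⟩ := Nat.exists_eq_add_of_le' (show 6 ≤ k by omega)
    have hpow : 2 ^ (J + 6) = 64 * 2 ^ J := by ring
    rw [hpow] at hp0 ⊢
    obtain ⟨A, hA⟩ := OnlinePart.exists_algorithm_of_large (J := J) (by omega)
    exact ⟨A, fun X =>
      OnlinePart.bottleneck_bound_of_average hp0 (hA X) (by positivity) (by norm_num)⟩
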